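/- Fix a non-zero complex number $\eta$, and let $\Delta f(z)=f(z+\eta)-f(z)$, $\Delta^0 f=f$ and $\Delta^{n}f=\Delta(\Delta^{n-1}f)$ for $n\ge 1$. Let $f$ be a meromorphic function on $\mathbb{C}$ of order $$\sigma=\limsup_{r\to\infty}\frac{\log^+T(r,f)}{\log r}<1,$$ where $T(r,f)$ is the Nevanlinna characteristic of $f$. Then for each $\varepsilon>0$ and all integers $0\le j<k$ such that $\Delta^jf\not\equiv 0$, there exists a set $E\subset(1,\infty)$ (which may depend on $f$, $\eta$, $\varepsilon$, $j$ and $k$) of finite logarithmic measure, that is, $\int_{E}\frac{dr}{r}<\infty$, such that for all $z$ with $|z|\notin E\cup[0,1]$ the point $z$ is neither a pole of $\Delta^jf$ or $\Delta^kf$ nor a zero of $\Delta^jf$, and $$\left|\frac{\Delta^kf(z)}{\Delta^jf(z)}\right|\le|z|^{(k-j)(\sigma-1)+\varepsilon}.$$ -/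

import Mathlib

open Filter Set MeasureTheory
open scoped Real

noncomputable section

/-- The (Nevanlinna) order `limsup_{r → ∞} log⁺ T(r, f) / log r` of a function `f` on the complex
plane, where `T(r, f)` is the Nevanlinna characteristic. It takes values in the extended reals, so
that functions of infinite order have order `⊤`. -/
def nevanlinnaOrder (f : ℂ → ℂ) : EReal :=
  limsup (fun r : ℝ => ((log⁺ (ValueDistribution.characteristic f ⊤ r) / Real.log r : ℝ) : EReal))
    atTop

/-- The logarithmic measure `∫_{E ∩ (1, ∞)} dr / r` of a set of reals. -/
def logMeasure (E : Set ℝ) : ENNReal :=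
  ∫⁻ r in E ∩ Ioi 1, ENNReal.ofReal (1 / r)

end

/-! ### Factorisation on a disc and control of the zero-free factor. -/

section
open Metric Topology ValueDistribution
open Real (circleAverage)

/-! It suffices to bound `Δf / f` by `|z| ^ (σ - 1 + ε)`, because `Δf` again has order at most `σ`
(`HasOrderLE.fwdDiff`) and the quotients of successive differences telescope.

For `A ≤ |z| < 2A`, write `f = ∏ (z - a) ^ ord a * g` on the disc of radius `R = 8A`, with `g`
zero-free. Jensen's formula bounds the circle mean of `|log ‖g‖|` by `O(R ^ (σ + ε'))`; the Poisson
kernel and Borel–Carathéodory then give `g (z + η) = g z * exp w` with `w = O(R ^ (σ - 1 + ε'))`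
(`exists_shift_eq_mul_exp`). The product contributes `∑ ord a * log (1 + η / (z - a))`, of size at
most a constant times `∑ |ord a| / |z - a|`.

That sum is small off a small set of radii. As `1 / |r - |a||` is not integrable, one integrates its
power `p < 1`, applies Markov's inequality on each dyadic interval (`volume_le_sum_rpow_neg_le`),
and returns to exponent `1` by `sum_inv_le_rpow`. Hence `f (z + η) = f z * exp W` with `W` small,
since `σ < 1`, and `Δf / f = exp W - 1`. -/

/-- The zeros and poles of `f` in the closed disc of radius `R`. -/
noncomputable def zerosPoles (f : ℂ → ℂ) (R : ℝ) : Finset ℂ :=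
  ((MeromorphicOn.divisor f (closedBall 0 R)).finiteSupport (isCompact_closedBall 0 R)).toFinset

/-- The order of `f` at `a`, an integer, with the value `0` if `f` vanishes identically near `a`. -/
noncomputable def ord (f : ℂ → ℂ) (a : ℂ) : ℤ := (meromorphicOrderAt f a).untop₀

/-- The number of zeros and poles of `f` in the closed disc of radius `R`, with multiplicity. -/
noncomputable def zpCount (f : ℂ → ℂ) (R : ℝ) : ℝ := ∑ a ∈ zerosPoles f R, |(ord f a : ℝ)|

lemma zpCount_nonneg (f : ℂ → ℂ) (R : ℝ) : 0 ≤ zpCount f R :=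
  Finset.sum_nonneg fun _ _ => abs_nonneg _

lemma mem_zerosPoles {f : ℂ → ℂ} (hf : Meromorphic f) {R : ℝ} {a : ℂ} :
    a ∈ zerosPoles f R ↔ ‖a‖ ≤ R ∧ ord f a ≠ 0 := by
  rw [zerosPoles, Set.Finite.mem_toFinset, Function.mem_support]
  by_cases ha : a ∈ closedBall (0 : ℂ) R
  · rw [MeromorphicOn.divisor_apply hf.meromorphicOn ha]
    have : ‖a‖ ≤ R := by simpa using ha
    simp only [this, ord, true_and]
  · have h2 : ¬ ‖a‖ ≤ R := by simpa using ha
    simp [ha, h2]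

lemma exists_factorization {f : ℂ → ℂ} (hf : Meromorphic f) (h0 : ∀ z, meromorphicOrderAt f z ≠ ⊤)
    (R : ℝ) : ∃ g : ℂ → ℂ, AnalyticOnNhd ℂ g (closedBall 0 R) ∧
      (∀ z ∈ closedBall (0 : ℂ) R, g z ≠ 0) ∧
      f =ᶠ[codiscreteWithin (closedBall 0 R)]
        fun z => (∏ a ∈ zerosPoles f R, (z - a) ^ ord f a) * g z := by
  have hfin := (MeromorphicOn.divisor f (closedBall 0 R)).finiteSupport (isCompact_closedBall 0 R)
  obtain ⟨g, hg, hg0, he⟩ := MeromorphicOn.extract_zeros_poles (f := f) (U := closedBall 0 R)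
    hf.meromorphicOn (fun u => h0 u) hfin
  refine ⟨g, hg, fun z hz => hg0 ⟨z, hz⟩, ?_⟩
  filter_upwards [he] with z hz
  rw [hz, Function.FactorizedRational.finprod_eq_fun hfin]
  simp only [Pi.smul_apply', smul_eq_mul]
  congr 1
  rw [finprod_eq_prod_of_mulSupport_subset (s := zerosPoles f R)]
  · refine Finset.prod_congr rfl fun a ha => ?_
    rw [MeromorphicOn.divisor_apply hf.meromorphicOn, ord]
    simpa using ((mem_zerosPoles hf).1 ha).1
  · intro a ha
    rw [zerosPoles, Set.Finite.coe_toFinset, Function.mem_support]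
    intro h
    exact ha (by simp [h])

lemma ord_eq_zero {f : ℂ → ℂ} {z : ℂ} (hz : AnalyticAt ℂ f z) (hz0 : f z ≠ 0) : ord f z = 0 := by
  rw [ord, hz.meromorphicNFAt.meromorphicOrderAt_eq_zero_iff.2 hz0]; rfl

/-- Both sides are continuous at `z` and agree on a punctured neighbourhood; no factor is singular
there because `z` is neither a zero nor a pole. -/
lemma eq_factorization {f : ℂ → ℂ} (hf : Meromorphic f) {R : ℝ} {g : ℂ → ℂ}
    (hg : AnalyticOnNhd ℂ g (closedBall 0 R))
    (he : f =ᶠ[codiscreteWithin (closedBall 0 R)]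
        fun z => (∏ a ∈ zerosPoles f R, (z - a) ^ ord f a) * g z)
    {z : ℂ} (hzR : ‖z‖ < R) (hz : AnalyticAt ℂ f z) (hz0 : f z ≠ 0) :
    f z = (∏ a ∈ zerosPoles f R, (z - a) ^ ord f a) * g z := by
  have hnhds : closedBall (0 : ℂ) R ∈ 𝓝 z :=
    mem_of_superset (isOpen_ball.mem_nhds (by simpa using hzR)) ball_subset_closedBall
  have hmem : z ∈ closedBall (0 : ℂ) R := mem_of_mem_nhds hnhds
  have h1 : f =ᶠ[𝓝[≠] z] fun z => (∏ a ∈ zerosPoles f R, (z - a) ^ ord f a) * g z := by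
    have := mem_codiscreteWithin_iff_forall_mem_nhdsNE.1 he z hmem
    filter_upwards [this, mem_nhdsWithin_of_mem_nhds hnhds] with w hw hw2
    rcases hw with hw | hw
    · exact hw
    · exact absurd hw2 hw
  have hc : ContinuousAt (fun z => (∏ a ∈ zerosPoles f R, (z - a) ^ ord f a) * g z) z := by
    refine ContinuousAt.mul ?_ (hg z hmem).continuousAt
    refine tendsto_finsetProd _ fun a ha => ?_
    refine ContinuousAt.zpow₀ (by fun_prop) _ (Or.inl ?_)
    rintro h
    rw [sub_eq_zero] at h
    exact ((mem_zerosPoles hf).1 ha).2 (h ▸ ord_eq_zero hz hz0)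
  exact tendsto_nhds_unique ((hz.continuousAt.tendsto.mono_left nhdsWithin_le_nhds).congr' h1)
    (hc.tendsto.mono_left nhdsWithin_le_nhds)

lemma circleIntegrable_abs_log_norm {f : ℂ → ℂ} (hf : Meromorphic f) (r : ℝ) :
    CircleIntegrable (fun z => |Real.log ‖f z‖|) 0 r :=
  IntervalIntegrable.abs (hf.meromorphicOn.circleIntegrable_log_norm (c := 0) (R := r))

lemma circleAverage_abs_log_norm {f : ℂ → ℂ} (hf : Meromorphic f) (r : ℝ) :
    circleAverage (fun z => |Real.log ‖f z‖|) 0 r = proximity f ⊤ r + proximity f⁻¹ ⊤ r := by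
  rw [proximity_top, proximity_top, ← Real.circleAverage_fun_add]
  · congr 1
    ext z
    have h1 := Real.half_mul_log_add_log_abs (x := ‖f z‖)
    have h2 := Real.posLog_sub_posLog_inv (x := ‖f z‖)
    simp only [Pi.inv_apply, norm_inv]
    linarith
  · exact hf.meromorphicOn.circleIntegrable_posLog_norm
  · exact hf.inv.meromorphicOn.circleIntegrable_posLog_norm

lemma meromorphic_sub_const (a : ℂ) : Meromorphic (fun z : ℂ => z - a) :=
  fun z => by fun_prop

/-- By Jensen's formula the mean of `log ‖z - a‖` is nonnegative when `r ≥ 1`, so adding it to the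
mean of the absolute value costs nothing and leaves twice the positive part, which is bounded
pointwise. -/
lemma circleAverage_abs_log_norm_sub_le (a : ℂ) {r : ℝ} (hr : 1 ≤ r) :
    circleAverage (fun z => |Real.log ‖z - a‖|) 0 r ≤ 2 * Real.log (r + ‖a‖ + 1) := by
  have h1 : 0 ≤ circleAverage (fun z => Real.log ‖z - a‖) 0 r := by
    rw [circleAverage_log_norm_sub_const_eq_log_radius_add_posLog (by positivity)]
    have := Real.log_nonneg hr
    have := Real.posLog_nonneg (x := r⁻¹ * ‖(0 : ℂ) - a‖)
    linarith
  have hi := (meromorphic_sub_const a).meromorphicOn.circleIntegrable_log_norm (c := 0) (R := r)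
  have h2 : circleAverage (fun z => |Real.log ‖z - a‖| + Real.log ‖z - a‖) 0 r
      ≤ 2 * Real.log (r + ‖a‖ + 1) := by
    refine Real.circleAverage_mono_on_of_le_circle
      ((circleIntegrable_abs_log_norm (meromorphic_sub_const a) r).add hi) fun z hz => ?_
    have hz' : ‖z‖ = r := by simpa [abs_of_pos (by linarith : (0 : ℝ) < r)] using hz
    have hle : ‖z - a‖ ≤ r + ‖a‖ + 1 := by linarith [norm_sub_le z a]
    have hpos : 0 ≤ Real.log (r + ‖a‖ + 1) := Real.log_nonneg (by linarith [norm_nonneg a])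
    rcases le_total 0 (Real.log ‖z - a‖) with h | h
    · rw [abs_of_nonneg h]
      rcases eq_or_lt_of_le (norm_nonneg (z - a)) with h0 | h0
      · rw [← h0]; simpa using hpos
      · linarith [Real.log_le_log h0 hle]
    · rw [abs_of_nonpos h]; linarith
  rw [Real.circleAverage_fun_add (circleIntegrable_abs_log_norm (meromorphic_sub_const a) r) hi]
    at h2
  linarith

/-- A bound for the circle average of `|log ‖g‖|`, where `g` is the zero-free part of `f` on the disc
of radius `R`. -/
noncomputable def zeroFreeBound (f : ℂ → ℂ) (R : ℝ) : ℝ :=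
  proximity f ⊤ R + proximity f⁻¹ ⊤ R + zpCount f R * (2 * Real.log (2 * R + 1))

lemma zeroFreeBound_nonneg (f : ℂ → ℂ) {R : ℝ} (hR : 1 ≤ R) : 0 ≤ zeroFreeBound f R := by
  have h1 := proximity_nonneg (f := f) (a := ⊤) R
  have h2 := proximity_nonneg (f := f⁻¹) (a := ⊤) R
  have h3 := zpCount_nonneg f R
  have h4 : 0 ≤ Real.log (2 * R + 1) := Real.log_nonneg (by linarith)
  simp only [Pi.zero_apply] at h1 h2
  unfold zeroFreeBound
  positivity

lemma circleAverage_abs_sum_le {ι : Type*} (s : Finset ι) (d : ι → ℝ) (a : ι → ℂ) {r B : ℝ}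
    (hr : 1 ≤ r) (hB : ∀ i ∈ s, ‖a i‖ ≤ B) :
    CircleIntegrable (fun z => ∑ i ∈ s, |d i| * |Real.log ‖z - a i‖|) 0 r ∧
    circleAverage (fun z => ∑ i ∈ s, |d i| * |Real.log ‖z - a i‖|) 0 r
      ≤ (∑ i ∈ s, |d i|) * (2 * Real.log (r + B + 1)) := by
  have hi : ∀ i ∈ s, CircleIntegrable (fun z => |d i| * |Real.log ‖z - a i‖|) 0 r := fun i _ =>
    (circleIntegrable_abs_log_norm (meromorphic_sub_const (a i)) r).const_mul _
  refine ⟨CircleIntegrable.fun_sum s hi, ?_⟩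
  rw [Real.circleAverage_fun_sum hi, Finset.sum_mul]
  refine Finset.sum_le_sum fun i his => ?_
  have := Real.circleAverage_fun_smul (a := |d i|) (f := fun z => |Real.log ‖z - a i‖|)
    (c := 0) (R := r)
  simp only [smul_eq_mul] at this
  rw [this]
  refine mul_le_mul_of_nonneg_left ?_ (abs_nonneg _)
  refine (circleAverage_abs_log_norm_sub_le (a i) hr).trans ?_
  have := hB i his
  have := norm_nonneg (a i)
  have := Real.log_le_log (x := r + ‖a i‖ + 1) (y := r + B + 1) (by linarith) (by linarith)
  linarith

lemma log_norm_factorization {s : Finset ℂ} {d : ℂ → ℤ} {z w : ℂ} (hz : z ∉ s) (hw : w ≠ 0) :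
    Real.log ‖(∏ a ∈ s, (z - a) ^ d a) * w‖
      = (∑ a ∈ s, (d a : ℝ) * Real.log ‖z - a‖) + Real.log ‖w‖ := by
  have h0 : ∀ a ∈ s, ‖z - a‖ ≠ 0 := fun a ha h => by
    rw [norm_eq_zero, sub_eq_zero] at h; exact hz (h ▸ ha)
  rw [norm_mul, norm_prod, Real.log_mul _ (norm_ne_zero_iff.2 hw), Real.log_prod]
  · simp [Real.log_zpow]
  · intro a ha; rw [norm_zpow]; exact zpow_ne_zero _ (h0 a ha)
  · rw [Finset.prod_ne_zero_iff]
    intro a ha; rw [norm_zpow]; exact zpow_ne_zero _ (h0 a ha)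

lemma circleAverage_abs_log_norm_le_zeroFreeBound {f : ℂ → ℂ} (hf : Meromorphic f) {R : ℝ}
    (hR : 1 ≤ R) {g : ℂ → ℂ} (hg0 : ∀ z ∈ closedBall (0 : ℂ) R, g z ≠ 0)
    (he : f =ᶠ[codiscreteWithin (closedBall 0 R)]
        fun z => (∏ a ∈ zerosPoles f R, (z - a) ^ ord f a) * g z) :
    circleAverage (fun z => |Real.log ‖g z‖|) 0 R ≤ zeroFreeBound f R := by
  have hR' : |R| = R := abs_of_pos (by linarith)
  obtain ⟨hi, hs⟩ := circleAverage_abs_sum_le (zerosPoles f R) (fun a => (ord f a : ℝ)) (fun a => a)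
    hR (B := R) (fun a ha => ((mem_zerosPoles hf).1 ha).1)
  have hcongr : circleAverage (fun z => |Real.log ‖g z‖|) 0 R = circleAverage
      (fun z => |Real.log ‖f z‖ - ∑ a ∈ zerosPoles f R, (ord f a : ℝ) * Real.log ‖z - a‖|) 0 R := by
    refine Real.circleAverage_congr_codiscreteWithin ?_ (by linarith)
    rw [hR']
    have hsub : sphere (0 : ℂ) R ⊆ closedBall 0 R := sphere_subset_closedBall
    filter_upwards [codiscreteWithin_mono hsub he, self_mem_codiscreteWithin (sphere (0 : ℂ) R),
      compl_finite_mem_codiscreteWithin (s := sphere (0 : ℂ) R) (zerosPoles f R).finite_toSet]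
      with z hz hzs hzf
    rw [hz, log_norm_factorization (by simpa using hzf) (hg0 z (hsub hzs)), add_sub_cancel_left]
  have hfi := circleIntegrable_abs_log_norm hf R
  have hsi : CircleIntegrable (fun z => ∑ a ∈ zerosPoles f R, (ord f a : ℝ) * Real.log ‖z - a‖) 0 R :=
    CircleIntegrable.fun_sum _ fun a _ => IntervalIntegrable.const_mul
      ((meromorphic_sub_const a).meromorphicOn.circleIntegrable_log_norm (c := 0) (R := R)) _
  rw [hcongr]
  calc _ ≤ circleAverage (fun z => |Real.log ‖f z‖| +
        ∑ a ∈ zerosPoles f R, |(ord f a : ℝ)| * |Real.log ‖z - a‖|) 0 R := by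
        refine Real.circleAverage_mono ?_ (hfi.add hi) fun z _ => ?_
        · exact IntervalIntegrable.abs
            ((hf.meromorphicOn.circleIntegrable_log_norm (c := 0) (R := R)).sub hsi)
        · refine (abs_sub _ _).trans (add_le_add le_rfl ?_)
          refine (Finset.abs_sum_le_sum_abs _ _).trans (le_of_eq ?_)
          exact Finset.sum_congr rfl fun a _ => abs_mul _ _
    _ ≤ _ := by
        rw [Real.circleAverage_fun_add hfi hi, circleAverage_abs_log_norm hf, zeroFreeBound, zpCount,
          two_mul R]
        linarith

/-! ### Harmonic estimates and the shift of a zero-free function. -/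

/-- Poisson's formula: the kernel lies between `0` and `(R + ‖w‖) / (R - ‖w‖) ≤ 3`. -/
lemma abs_harmonic_le {u : ℂ → ℝ} {R : ℝ} (hR : 0 < R)
    (hu : InnerProductSpace.HarmonicOnNhd u (closedBall (0 : ℂ) R))
    {w : ℂ} (hw : ‖w‖ ≤ R / 2) : |u w| ≤ 3 * circleAverage (fun z => |u z|) 0 R := by
  have hwb : w ∈ ball (0 : ℂ) R := by simp; linarith
  have hcu : ContinuousOn u (sphere (0 : ℂ) |R|) := by
    rw [abs_of_pos hR]
    exact fun z hz => (hu z (sphere_subset_closedBall hz)).1.continuousAt.continuousWithinAt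
  have hck : ContinuousOn (Complex.re ∘ herglotzRieszKernel 0 w) (sphere (0 : ℂ) |R|) :=
    Complex.continuous_re.comp_continuousOn (continuousOn_herglotzRieszKernel_sphere hwb)
  have hP := hu.circleAverage_re_herglotzRieszKernel_smul hwb
  have hmul : circleAverage (fun z => 3 * |u z|) 0 R = 3 * circleAverage (fun z => |u z|) 0 R := by
    simpa only [smul_eq_mul] using
      Real.circleAverage_fun_smul (a := (3 : ℝ)) (f := fun z => |u z|) (c := 0) (R := R)
  rw [← hP, ← hmul]
  refine Real.abs_circleAverage_le_circleAverage_abs.trans (Real.circleAverage_mono ?_ ?_ ?_)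
  · exact (hck.smul hcu).abs.circleIntegrable'
  · exact (continuousOn_const.mul hcu.abs).circleIntegrable'
  · intro z hz
    rw [abs_of_pos hR] at hz
    have h1 := re_herglotzRieszKernel_le hz hwb
    have h2 := le_re_herglotzRieszKernel hz hwb
    have hw0 := norm_nonneg w
    change |(herglotzRieszKernel 0 w z).re * u z| ≤ 3 * |u z|
    rw [abs_mul, herglotzRieszKernel_def]
    refine mul_le_mul_of_nonneg_right ?_ (abs_nonneg _)
    simp only [sub_zero] at h1 h2 ⊢
    rw [abs_of_nonneg (le_trans (div_nonneg (by linarith) (by linarith)) h2)]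
    refine h1.trans ?_
    rw [div_le_iff₀ (by linarith)]
    linarith

lemma abs_log_norm_le {g : ℂ → ℂ} {R M : ℝ} (hR : 0 < R)
    (hg : AnalyticOnNhd ℂ g (closedBall 0 R)) (hg0 : ∀ z ∈ closedBall (0 : ℂ) R, g z ≠ 0)
    (hM : circleAverage (fun z => |Real.log ‖g z‖|) 0 R ≤ M) {w : ℂ} (hw : ‖w‖ ≤ R / 2) :
    |Real.log ‖g w‖| ≤ 3 * M :=
  (abs_harmonic_le (u := fun z => Real.log ‖g z‖) hR
    (fun z hz => (hg z hz).harmonicAt_log_norm (hg0 z hz)) hw).trans (by linarith)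

/-- The harmonic function `log ‖g‖` is the real part of some analytic `F`. Then `exp F / g` has
modulus `1` and is constant by the maximum principle. -/
lemma exists_exp_eq {g : ℂ → ℂ} {R : ℝ}
    (hg : AnalyticOnNhd ℂ g (ball 0 R)) (hg0 : ∀ z ∈ ball (0 : ℂ) R, g z ≠ 0) :
    ∃ F : ℂ → ℂ, AnalyticOnNhd ℂ F (ball 0 R) ∧ (∀ z ∈ ball (0 : ℂ) R, (F z).re = Real.log ‖g z‖) ∧
      ∀ z ∈ ball (0 : ℂ) R, ∀ w ∈ ball (0 : ℂ) R, g w = g z * Complex.exp (F w - F z) := by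
  obtain ⟨F, hF, hre⟩ := InnerProductSpace.HarmonicOnNhd.exists_analyticOnNhd_ball_re_eq
    (f := fun z => Real.log ‖g z‖) (z := 0) (R := R)
    (fun z hz => (hg z hz).harmonicAt_log_norm (hg0 z hz))
  refine ⟨F, hF, fun z hz => hre hz, fun z hz w hw => ?_⟩
  have hnorm : ∀ z ∈ ball (0 : ℂ) R, ‖Complex.exp (F z) / g z‖ = 1 := fun z hz => by
    rw [norm_div, Complex.norm_exp, show (F z).re = _ from hre hz,
      Real.exp_log (norm_pos_iff.2 (hg0 z hz)), div_self (norm_ne_zero_iff.2 (hg0 z hz))]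
  have hd : DifferentiableOn ℂ (fun z => Complex.exp (F z) / g z) (ball 0 R) :=
    (hF.differentiableOn.cexp).div hg.differentiableOn hg0
  have := Complex.eqOn_of_isPreconnected_of_isMaxOn_norm (convex_ball (0 : ℂ) R).isPreconnected
    isOpen_ball hd hz (fun y hy => ((hnorm y hy).trans (hnorm z hz).symm).le) hw
  simp only [Function.const_apply] at this
  rw [div_eq_div_iff (hg0 w hw) (hg0 z hz)] at this
  rw [Complex.exp_sub, mul_div_assoc', eq_div_iff (Complex.exp_ne_zero _), mul_comm (g w), mul_comm (g z)]
  exact this.symm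

lemma exists_shift_eq_mul_exp {g : ℂ → ℂ} {R M : ℝ} (hR : 0 < R)
    (hg : AnalyticOnNhd ℂ g (closedBall 0 R)) (hg0 : ∀ z ∈ closedBall (0 : ℂ) R, g z ≠ 0)
    (hM : circleAverage (fun z => |Real.log ‖g z‖|) 0 R ≤ M) (hM0 : 0 < M)
    {z η : ℂ} (hz : ‖z‖ ≤ R / 4) (hη : ‖η‖ ≤ R / 8) :
    ∃ w : ℂ, g (z + η) = g z * Complex.exp w ∧ ‖w‖ ≤ 96 * M * ‖η‖ / R := by
  obtain ⟨F, hF, hre, hexp⟩ := exists_exp_eq (hg.mono ball_subset_closedBall)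
    (fun z hz => hg0 z (ball_subset_closedBall hz))
  have hmem : ∀ y : ℂ, ‖y‖ < R / 4 → z + y ∈ ball (0 : ℂ) R := fun y hy => by
    simp only [mem_ball, dist_zero_right]
    linarith [norm_add_le z y]
  have hη4 : ‖η‖ < R / 4 := by linarith
  have hz0 : z ∈ ball (0 : ℂ) R := by simpa using hmem 0 (by simpa using (by linarith))
  refine ⟨F (z + η) - F z, hexp z hz0 _ (hmem η hη4), ?_⟩
  -- The increment of `F` vanishes at `y = 0`, which yields the gain `‖η‖ / R`. Its real part is a
  -- difference of two values of `log ‖g‖`, each at most `3 * M` in absolute value.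
  have hb := Complex.borelCaratheodory_zero (f := fun y => F (z + y) - F z) (M := 6 * M)
    (R := R / 4) (z := η) (by positivity) ?_ ?_ (by positivity) (by simpa using hη4) (by simp)
  · refine hb.trans ?_
    have h1 : R / 8 ≤ R / 4 - ‖η‖ := by linarith
    calc 2 * (6 * M) * ‖η‖ / (R / 4 - ‖η‖) ≤ 2 * (6 * M) * ‖η‖ / (R / 8) := by gcongr
      _ = 96 * M * ‖η‖ / R := by field_simp; ring
  · intro y hy
    have hy' := hmem y (by simpa using hy)
    refine DifferentiableAt.differentiableWithinAt ?_
    refine DifferentiableAt.sub_const ?_ _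
    exact DifferentiableAt.comp y (hF _ hy').differentiableAt (by fun_prop)
  · intro y hy
    have hy4 : ‖y‖ < R / 4 := by simpa using hy
    have hb1 := abs_log_norm_le hR hg hg0 hM (w := z) (by linarith)
    have hb2 := abs_log_norm_le hR hg hg0 hM (w := z + y) (by linarith [norm_add_le z y])
    have e1 := hre z hz0
    have e2 := hre (z + y) (hmem y hy4)
    simp only [Set.mem_ofPred_eq, Complex.sub_re, e1, e2]
    linarith [le_abs_self (Real.log ‖g (z + y)‖), neg_abs_le (Real.log ‖g z‖)]
end

/-! ### Order of growth and counting functions. -/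

section
open Metric Topology ValueDistribution Asymptotics
open Real (circleAverage)

/-- `u` has order of growth at most `σ`. -/
def OrderLE (σ : ℝ) (u : ℝ → ℝ) : Prop := ∀ τ > σ, u =O[atTop] (fun r => r ^ τ)

namespace OrderLE
variable {σ : ℝ} {u v : ℝ → ℝ}

lemma add (hu : OrderLE σ u) (hv : OrderLE σ v) : OrderLE σ (fun r => u r + v r) :=
  fun τ hτ => (hu τ hτ).add (hv τ hτ)

lemma const_mul (hu : OrderLE σ u) (c : ℝ) : OrderLE σ (fun r => c * u r) :=
  fun τ hτ => (hu τ hτ).const_mul_left c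

lemma const (hσ : 0 ≤ σ) (c : ℝ) : OrderLE σ (fun _ => c) := fun τ hτ => by
  have h : Tendsto (fun r : ℝ => ‖r ^ τ‖) atTop atTop :=
    tendsto_norm_atTop_atTop.comp (tendsto_rpow_atTop (hσ.trans_lt hτ))
  exact (isLittleO_const_left.2 (Or.inr h)).isBigO

lemma mono (hv : OrderLE σ v) (h : ∀ᶠ r in atTop, |u r| ≤ v r) : OrderLE σ u := fun τ hτ => by
  refine IsBigO.trans (IsBigO.of_bound 1 ?_) (hv τ hτ)
  filter_upwards [h] with r hr
  rw [one_mul]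
  exact hr.trans (le_abs_self _)

lemma comp_mul (hu : OrderLE σ u) {c : ℝ} (hc : 0 < c) : OrderLE σ (fun r => u (c * r)) :=
  fun τ hτ => by
  have h1 := (hu τ hτ).comp_tendsto (tendsto_id.const_mul_atTop hc)
  refine h1.trans (IsBigO.of_bound (c ^ τ) ?_)
  filter_upwards [eventually_ge_atTop 0] with r hr
  simp only [Function.comp_apply, id]
  rw [Real.mul_rpow hc.le hr, norm_mul, Real.norm_of_nonneg (Real.rpow_nonneg hc.le _)]

lemma mul_log (hu : OrderLE σ u) : OrderLE σ (fun r => u r * Real.log r) := fun τ hτ => by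
  have h1 := (hu ((σ + τ) / 2) (by linarith)).mul
    (isLittleO_log_rpow_atTop (r := (τ - σ) / 2) (by linarith)).isBigO
  refine h1.trans (IsBigO.of_bound 1 ?_)
  filter_upwards [eventually_gt_atTop 0] with r hr
  rw [← Real.rpow_add hr, one_mul]
  apply le_of_eq
  congr 2
  ring

end OrderLE

lemma orderLE_of_nevanlinnaOrder {f : ℂ → ℂ} {σ : ℝ} (h : nevanlinnaOrder f = (σ : EReal)) :
    0 ≤ σ ∧ OrderLE σ (characteristic f ⊤) := by
  constructor
  · have : (0 : EReal) ≤ nevanlinnaOrder f := by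
      refine le_limsup_of_frequently_le' ?_
      refine Eventually.frequently ?_
      filter_upwards [eventually_ge_atTop 1] with r hr
      exact_mod_cast div_nonneg Real.posLog_nonneg (Real.log_nonneg hr)
    rw [h] at this
    exact_mod_cast this
  · intro τ hτ
    have hlt : nevanlinnaOrder f < (τ : EReal) := by rw [h]; exact_mod_cast hτ
    refine IsBigO.of_bound 1 ?_
    filter_upwards [eventually_lt_of_limsup_lt hlt, eventually_gt_atTop 1] with r hr hr1
    have hlog := Real.log_pos hr1
    have hr' : log⁺ (characteristic f ⊤ r) / Real.log r < τ := by exact_mod_cast hr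
    rw [div_lt_iff₀ hlog] at hr'
    have h0 := characteristic_nonneg (f := f) (a := ⊤) hr1.le
    rw [Real.norm_of_nonneg h0, one_mul, Real.norm_of_nonneg (Real.rpow_nonneg (by linarith) _),
      Real.rpow_def_of_pos (by linarith), mul_comm]
    rcases eq_or_lt_of_le h0 with h0 | h0
    · rw [← h0]; positivity
    · calc characteristic f ⊤ r = Real.exp (Real.log (characteristic f ⊤ r)) :=
            (Real.exp_log h0).symm
        _ ≤ _ := Real.exp_le_exp.2 ((Real.posLog_def ▸ le_max_right _ _ :
            Real.log (characteristic f ⊤ r) ≤ log⁺ (characteristic f ⊤ r)).trans hr'.le)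

lemma logCounting_add_logCounting {f : ℂ → ℂ} (hf : Meromorphic f) {r : ℝ} (hr : 0 ≤ r) :
    logCounting f 0 r + logCounting f ⊤ r =
      ∑ a ∈ zerosPoles f r, |(ord f a : ℝ)| * Real.log (r * ‖a‖⁻¹)
        + |(ord f 0 : ℝ)| * Real.log r := by
  have hD : ∀ a, (((MeromorphicOn.divisor f univ)⁺ + (MeromorphicOn.divisor f univ)⁻) a : ℤ)
      = |ord f a| := fun a => by
    rw [Function.locallyFinsuppWithin.coe_add, Pi.add_apply]
    simp only [Function.locallyFinsuppWithin.posPart_apply,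
      Function.locallyFinsuppWithin.negPart_apply,
      MeromorphicOn.divisor_apply hf.meromorphicOn (mem_univ a)]
    exact posPart_add_negPart _
  rw [logCounting_zero, logCounting_top, ← Pi.add_apply, ← map_add]
  simp only [Function.locallyFinsuppWithin.logCounting, AddMonoidHom.coe_mk, ZeroHom.coe_mk, hD]
  have hr' : |r| = r := abs_of_nonneg hr
  rw [finsum_eq_sum_of_support_subset (s := zerosPoles f r)]
  · congr 1
    · refine Finset.sum_congr rfl fun a ha => ?_
      rw [Function.locallyFinsuppWithin.toClosedBall_eval_within, hD, Int.cast_abs]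
      simpa [hr'] using ((mem_zerosPoles hf).1 ha).1
    · rw [Int.cast_abs]
  · intro a ha
    rw [Finset.mem_coe, mem_zerosPoles hf]
    by_cases hab : a ∈ closedBall (0 : ℂ) |r|
    · refine ⟨by simpa [hr'] using hab, fun h => ha ?_⟩
      beta_reduce
      rw [Function.locallyFinsuppWithin.toClosedBall_eval_within _ hab, hD, h]
      simp
    · exact absurd (by simp [Function.locallyFinsuppWithin.apply_eq_zero_of_notMem _ hab]) ha
end

section
open Metric Topology ValueDistribution Asymptotics
open Real (circleAverage)

/-- Enlarging the radius by the factor `e` makes every logarithmic weight `log (e * r / ‖a‖)` at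
least `1`, as is the weight of the origin. -/
lemma zpCount_le_logCounting {f : ℂ → ℂ} (hf : Meromorphic f) {r : ℝ} (hr : 1 ≤ r) :
    zpCount f r ≤ logCounting f 0 (Real.exp 1 * r) + logCounting f ⊤ (Real.exp 1 * r) := by
  have he : 1 ≤ Real.exp 1 := Real.one_le_exp zero_le_one
  have hle : r ≤ Real.exp 1 * r := le_mul_of_one_le_left (by linarith) he
  have hlog : 1 ≤ Real.log (Real.exp 1 * r) := by
    rw [Real.log_mul (Real.exp_ne_zero _) (by linarith), Real.log_exp]
    linarith [Real.log_nonneg hr]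
  rw [logCounting_add_logCounting hf (by linarith), zpCount]
  set ρ := Real.exp 1 * r with hρ
  have hterm : ∀ a ∈ zerosPoles f ρ, 0 ≤ |(ord f a : ℝ)| * Real.log (ρ * ‖a‖⁻¹) := fun a ha => by
    have ha' := ((mem_zerosPoles hf).1 ha).1
    rcases eq_or_ne a 0 with rfl | h0
    · simp
    · have : 0 < ‖a‖ := norm_pos_iff.2 h0
      refine mul_nonneg (abs_nonneg _) (Real.log_nonneg ?_)
      rwa [← div_eq_mul_inv, one_le_div this]
  have hsub : (zerosPoles f r).erase 0 ⊆ zerosPoles f ρ := fun a ha => by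
    have := (mem_zerosPoles hf).1 (Finset.mem_of_mem_erase ha)
    exact (mem_zerosPoles hf).2 ⟨this.1.trans hle, this.2⟩
  have h1 : ∑ a ∈ (zerosPoles f r).erase 0, |(ord f a : ℝ)|
      ≤ ∑ a ∈ zerosPoles f ρ, |(ord f a : ℝ)| * Real.log (ρ * ‖a‖⁻¹) := by
    refine le_trans ?_ (Finset.sum_le_sum_of_subset_of_nonneg hsub fun a ha _ => hterm a ha)
    refine Finset.sum_le_sum fun a ha => ?_
    have ha' := ((mem_zerosPoles hf).1 (Finset.mem_of_mem_erase ha)).1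
    have hpos : 0 < ‖a‖ := norm_pos_iff.2 (Finset.ne_of_mem_erase ha)
    refine le_mul_of_one_le_right (abs_nonneg _) ?_
    rw [← Real.log_exp 1]
    refine Real.log_le_log (Real.exp_pos _) ?_
    rw [hρ, mul_assoc, ← div_eq_mul_inv]
    exact le_mul_of_one_le_right (Real.exp_pos _).le ((one_le_div hpos).2 ha')
  have h2 : ∑ a ∈ zerosPoles f r, |(ord f a : ℝ)|
      ≤ ∑ a ∈ (zerosPoles f r).erase 0, |(ord f a : ℝ)| + |(ord f 0 : ℝ)| := by
    by_cases h : (0 : ℂ) ∈ zerosPoles f r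
    · rw [Finset.sum_erase_add _ _ h]
    · rw [Finset.erase_eq_of_notMem h]
      linarith [abs_nonneg (ord f 0 : ℝ)]
  have h3 : |(ord f 0 : ℝ)| ≤ |(ord f 0 : ℝ)| * Real.log ρ :=
    le_mul_of_one_le_right (abs_nonneg _) hlog
  linarith

lemma zpCount_mono {f : ℂ → ℂ} (hf : Meromorphic f) {r s : ℝ} (h : r ≤ s) :
    zpCount f r ≤ zpCount f s := by
  refine Finset.sum_le_sum_of_subset_of_nonneg (fun a ha => ?_) fun _ _ _ => abs_nonneg _
  have := (mem_zerosPoles hf).1 ha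
  exact (mem_zerosPoles hf).2 ⟨this.1.trans h, this.2⟩

/-- Points outside the unit disc have weight at most `log r`; the excess of the finitely many others
goes into `C`. The factor `2` absorbs the separate term of the origin. -/
lemma logCounting_top_le_zpCount {f : ℂ → ℂ} (hf : Meromorphic f) : ∃ C : ℝ, ∀ r : ℝ, 1 ≤ r →
    logCounting f ⊤ r ≤ 2 * (zpCount f r * Real.log r) + C := by
  refine ⟨∑ a ∈ zerosPoles f 1, |(ord f a : ℝ)| * |Real.log ‖a‖|, fun r hr => ?_⟩
  have hlog := Real.log_nonneg hr
  have h0 : 0 ≤ logCounting f 0 r := logCounting_nonneg hr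
  have hsub : zerosPoles f 1 ⊆ zerosPoles f r := fun a ha => by
    have := (mem_zerosPoles hf).1 ha
    exact (mem_zerosPoles hf).2 ⟨this.1.trans hr, this.2⟩
  have h1 : ∑ a ∈ zerosPoles f r, |(ord f a : ℝ)| * Real.log (r * ‖a‖⁻¹) ≤
      zpCount f r * Real.log r + ∑ a ∈ zerosPoles f 1, |(ord f a : ℝ)| * |Real.log ‖a‖| := by
    have : ∑ a ∈ zerosPoles f 1, |(ord f a : ℝ)| * |Real.log ‖a‖| = ∑ a ∈ zerosPoles f r,
        if a ∈ zerosPoles f 1 then |(ord f a : ℝ)| * |Real.log ‖a‖| else 0 := by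
      rw [Finset.sum_ite_mem, Finset.inter_eq_right.2 hsub]
    rw [this, zpCount, Finset.sum_mul, ← Finset.sum_add_distrib]
    refine Finset.sum_le_sum fun a ha => ?_
    have ha' := (mem_zerosPoles hf).1 ha
    split_ifs with h
    · rw [← mul_add]
      refine mul_le_mul_of_nonneg_left ?_ (abs_nonneg _)
      rcases eq_or_ne a 0 with rfl | ha0
      · simpa using hlog
      · rw [Real.log_mul (by linarith) (inv_ne_zero (norm_ne_zero_iff.2 ha0)), Real.log_inv]
        linarith [neg_abs_le (Real.log ‖a‖)]
    · have h1a : 1 < ‖a‖ := by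
        by_contra hcon
        exact h ((mem_zerosPoles hf).2 ⟨not_lt.1 hcon, ha'.2⟩)
      rw [add_zero]
      refine mul_le_mul_of_nonneg_left ?_ (abs_nonneg _)
      refine Real.log_le_log (by positivity) ?_
      exact mul_le_of_le_one_right (by linarith) (inv_le_one_of_one_le₀ h1a.le)
  have h2 : |(ord f 0 : ℝ)| * Real.log r ≤ zpCount f r * Real.log r := by
    refine mul_le_mul_of_nonneg_right ?_ hlog
    by_cases h : ord f 0 = 0
    · simp [h, zpCount_nonneg]
    · exact Finset.single_le_sum (f := fun a => |(ord f a : ℝ)|) (fun _ _ => abs_nonneg _)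
        ((mem_zerosPoles hf).2 ⟨by simp; linarith, h⟩)
  have := logCounting_add_logCounting hf (r := r) (by linarith)
  linarith

/-! ### Growth of shifts and differences. -/

lemma meromorphic_shift {f : ℂ → ℂ} (hf : Meromorphic f) (η : ℂ) :
    Meromorphic (fun z => f (z + η)) := by
  simpa using hf

lemma ord_shift (f : ℂ → ℂ) (η a : ℂ) : ord (fun z => f (z + η)) a = ord f (a + η) := by
  rw [ord, ord, ← meromorphicOrderAt_comp_add_const_eq_meromorphicOrderAt]; rfl

lemma zpCount_shift_le {f : ℂ → ℂ} (hf : Meromorphic f) (η : ℂ) (r : ℝ) :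
    zpCount (fun z => f (z + η)) r ≤ zpCount f (r + ‖η‖) := by
  rw [zpCount, zpCount]
  simp only [ord_shift]
  rw [← Finset.sum_image (f := fun b => |(ord f b : ℝ)|) (g := fun a => a + η)
    (fun _ _ _ _ h => add_right_cancel h)]
  refine Finset.sum_le_sum_of_subset_of_nonneg (fun b hb => ?_) fun _ _ _ => abs_nonneg _
  obtain ⟨a, ha, rfl⟩ := Finset.mem_image.1 hb
  have := (mem_zerosPoles (meromorphic_shift hf η)).1 ha
  rw [ord_shift] at this
  exact (mem_zerosPoles hf).2 ⟨(norm_add_le _ _).trans (by linarith [this.1]), this.2⟩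

lemma eventually_analyticAt_ne_zero {f : ℂ → ℂ} (hf : Meromorphic f)
    (h0 : ∀ z, meromorphicOrderAt f z ≠ ⊤) :
    {z | AnalyticAt ℂ f z ∧ f z ≠ 0} ∈ codiscrete ℂ := by
  rw [codiscrete, mem_codiscreteWithin_iff_forall_mem_nhdsNE]
  intro x _
  rw [compl_univ, union_empty]
  have h2 : ∀ᶠ z in 𝓝[≠] x, f z ≠ 0 := by
    rcases (hf x).eventually_eq_zero_or_eventually_ne_zero with h | h
    · exact absurd (meromorphicOrderAt_eq_top_iff.2 h) (h0 x)
    · exact h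
  filter_upwards [(hf x).eventually_analyticAt, h2] with z hz hz2 using ⟨hz, hz2⟩

lemma circleAverage_mono_codiscrete {u v : ℂ → ℝ} {r : ℝ} (hr : r ≠ 0)
    (hu : CircleIntegrable u 0 r) (hv : CircleIntegrable v 0 r)
    (h : ∀ᶠ z in codiscreteWithin (sphere (0 : ℂ) |r|), u z ≤ v z) :
    circleAverage u 0 r ≤ circleAverage v 0 r := by
  -- Replacing `u` by the minimum leaves its average unchanged and makes the inequality hold
  -- everywhere on the circle.
  have he : u =ᶠ[codiscreteWithin (sphere 0 |r|)] fun z => min (u z) (v z) := by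
    filter_upwards [h] with z hz
    exact (min_eq_left hz).symm
  rw [Real.circleAverage_congr_codiscreteWithin he hr]
  exact Real.circleAverage_mono (hu.congr_codiscreteWithin he) hv fun z _ => min_le_right _ _

/-- Factor `f` on the disc of radius `8 * r`. The linear factors become `z - (a - η)` with `‖a - η‖
≤ 9 * r`, and `z + η` stays in the half disc where `log ‖g‖` is controlled. -/
lemma proximity_shift_le {f : ℂ → ℂ} (hf : Meromorphic f) (h0 : ∀ z, meromorphicOrderAt f z ≠ ⊤)
    (η : ℂ) {r : ℝ} (hr : 1 ≤ r) (hη : ‖η‖ ≤ r) :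
    proximity (fun z => f (z + η)) ⊤ r
      ≤ zpCount f (8 * r) * (2 * Real.log (20 * r)) + 3 * zeroFreeBound f (8 * r) := by
  obtain ⟨g, hg, hg0, he⟩ := exists_factorization hf h0 (8 * r)
  have hM := circleAverage_abs_log_norm_le_zeroFreeBound hf (by linarith) hg0 he
  have hfη := meromorphic_shift hf η
  have h0η : ∀ z, meromorphicOrderAt (fun z => f (z + η)) z ≠ ⊤ := fun z => by
    have := h0 (z + η)
    rwa [← meromorphicOrderAt_comp_add_const_eq_meromorphicOrderAt] at this
  obtain ⟨hi, hs⟩ := circleAverage_abs_sum_le (zerosPoles f (8 * r)) (fun a => (ord f a : ℝ))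
    (fun a => a - η) hr (B := 9 * r)
    (fun a ha => by linarith [norm_sub_le a η, ((mem_zerosPoles hf).1 ha).1])
  have hci : CircleIntegrable (fun _ : ℂ => 3 * zeroFreeBound f (8 * r)) 0 r :=
    circleIntegrable_const _ _ _
  have hr0 : |r| = r := abs_of_pos (by linarith)
  rw [proximity_top]
  refine (circleAverage_mono_codiscrete (by linarith) hfη.meromorphicOn.circleIntegrable_posLog_norm
    (hi.add hci) ?_).trans ?_
  · filter_upwards [codiscreteWithin_mono (subset_univ _) (eventually_analyticAt_ne_zero hfη h0η),
      self_mem_codiscreteWithin (sphere (0 : ℂ) |r|)] with z hz hzs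
    have hzr : ‖z‖ = r := by simpa [hr0] using hzs
    have hzη : ‖z + η‖ ≤ 2 * r := by linarith [norm_add_le z η]
    have han : AnalyticAt ℂ f (z + η) := by
      have := AnalyticAt.fun_comp (f := fun w => w - η) (g := fun w => f (w + η)) (x := z + η)
        (by simpa using hz.1) (by fun_prop)
      simpa using this
    have hmem : z + η ∈ closedBall (0 : ℂ) (8 * r) := by simp; linarith
    have heq := eq_factorization hf hg he (by linarith) han hz.2
    have hgb := abs_log_norm_le (by linarith) hg hg0 hM (w := z + η) (by linarith)
    have hnot : z + η ∉ zerosPoles f (8 * r) := fun h =>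
      ((mem_zerosPoles hf).1 h).2 (ord_eq_zero han hz.2)
    have hpl : log⁺ ‖f (z + η)‖ ≤ |Real.log ‖f (z + η)‖| := by
      rw [Real.posLog_apply]; exact max_le (abs_nonneg _) (le_abs_self _)
    refine hpl.trans ?_
    rw [heq, log_norm_factorization hnot (hg0 _ hmem)]
    refine (abs_add_le _ _).trans (add_le_add ?_ hgb)
    refine (Finset.abs_sum_le_sum_abs _ _).trans (le_of_eq ?_)
    refine Finset.sum_congr rfl fun a _ => ?_
    rw [abs_mul, sub_sub_eq_add_sub]
  · have hadd := Real.circleAverage_fun_add hi hci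
    rw [Real.circleAverage_const] at hadd
    refine hadd.le.trans (add_le_add (hs.trans ?_) le_rfl)
    have := zpCount_nonneg f (8 * r)
    refine mul_le_mul_of_nonneg_left ?_ this
    have := Real.log_le_log (x := r + 9 * r + 1) (y := 20 * r) (by linarith) (by linarith)
    linarith

/-- The Nevanlinna characteristic of `f` has order of growth at most `σ`. -/
def HasOrderLE (σ : ℝ) (f : ℂ → ℂ) : Prop := Meromorphic f ∧ OrderLE σ (characteristic f ⊤)

namespace HasOrderLE
variable {σ : ℝ} {f : ℂ → ℂ}

/-- By Jensen's formula the characteristics of `f` and `f⁻¹` differ by a bounded amount. -/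
lemma inv (hσ : 0 ≤ σ) (h : HasOrderLE σ f) : HasOrderLE σ f⁻¹ := by
  refine ⟨h.1.inv, ?_⟩
  refine (h.2.add (OrderLE.const hσ (max |Real.log ‖f 0‖|
    |Real.log ‖meromorphicTrailingCoeffAt f 0‖|))).mono ?_
  filter_upwards [eventually_ge_atTop 1] with r hr
  have h1 := characteristic_sub_characteristic_inv_le h.1 (R := r)
  have h2 := characteristic_nonneg (f := f⁻¹) (a := ⊤) hr
  rw [abs_of_nonneg h2]
  linarith [neg_abs_le (characteristic f ⊤ r - characteristic f⁻¹ ⊤ r)]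

lemma proximity (h : HasOrderLE σ f) : OrderLE σ (proximity f ⊤) := by
  refine h.2.mono ?_
  filter_upwards [eventually_ge_atTop 1] with r hr
  have h1 := proximity_nonneg (f := f) (a := ⊤) r
  have h2 : 0 ≤ logCounting f ⊤ r := logCounting_nonneg hr
  rw [abs_of_nonneg h1, characteristic, Pi.add_apply]
  linarith

lemma logCounting (h : HasOrderLE σ f) : OrderLE σ (logCounting f ⊤) := by
  refine h.2.mono ?_
  filter_upwards [eventually_ge_atTop 1] with r hr
  have h1 := proximity_nonneg (f := f) (a := ⊤) r
  have h2 : 0 ≤ ValueDistribution.logCounting f ⊤ r := logCounting_nonneg hr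
  simp only [Pi.zero_apply] at h1
  rw [abs_of_nonneg h2, characteristic, Pi.add_apply]
  linarith

lemma zpCount (hσ : 0 ≤ σ) (h : HasOrderLE σ f) : OrderLE σ (zpCount f) := by
  have h1 := ((h.inv hσ).logCounting.comp_mul (Real.exp_pos 1)).add
    (h.logCounting.comp_mul (Real.exp_pos 1))
  refine h1.mono ?_
  filter_upwards [eventually_ge_atTop 1] with r hr
  rw [abs_of_nonneg (zpCount_nonneg f r), logCounting_inv]
  exact zpCount_le_logCounting h.1 hr

lemma zeroFreeBound (hσ : 0 ≤ σ) (h : HasOrderLE σ f) : OrderLE σ (zeroFreeBound f) := by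
  have hn := h.zpCount hσ
  have h1 := (h.proximity.add (h.inv hσ).proximity).add
    (((hn.const_mul (2 * Real.log 3)).add ((hn.mul_log).const_mul 2)))
  refine h1.mono ?_
  filter_upwards [eventually_ge_atTop 1] with r hr
  rw [abs_of_nonneg (zeroFreeBound_nonneg f hr), _root_.zeroFreeBound]
  have hlog : Real.log (2 * r + 1) ≤ Real.log 3 + Real.log r := by
    rw [← Real.log_mul (by norm_num) (by linarith)]
    exact Real.log_le_log (by linarith) (by linarith)
  have := mul_le_mul_of_nonneg_left hlog (zpCount_nonneg f r)
  linarith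

lemma shift (hσ : 0 ≤ σ) (h : HasOrderLE σ f) (h0 : ∀ z, meromorphicOrderAt f z ≠ ⊤) (η : ℂ) :
    HasOrderLE σ (fun z => f (z + η)) := by
  refine ⟨meromorphic_shift h.1 η, ?_⟩
  obtain ⟨C, hC⟩ := logCounting_top_le_zpCount (meromorphic_shift h.1 η)
  have hn := h.zpCount hσ
  have hn8 := hn.comp_mul (c := 8) (by norm_num)
  have h1 := ((((hn8.const_mul (2 * Real.log 20)).add (hn8.mul_log.const_mul 2)).add
    (((h.zeroFreeBound hσ).comp_mul (c := 8) (by norm_num)).const_mul 3)).add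
    ((hn.comp_mul (c := 2) (by norm_num)).mul_log.const_mul 2)).add (OrderLE.const hσ C)
  refine h1.mono ?_
  filter_upwards [eventually_ge_atTop 1, eventually_ge_atTop ‖η‖] with r hr hrη
  rw [abs_of_nonneg (characteristic_nonneg hr), characteristic, Pi.add_apply]
  have e1 := proximity_shift_le h.1 h0 η hr hrη
  have e2 := hC r hr
  have e3 := (zpCount_shift_le h.1 η r).trans (zpCount_mono h.1 (s := 2 * r) (by linarith))
  have e4 := mul_le_mul_of_nonneg_right e3 (Real.log_nonneg hr)
  rw [Real.log_mul (by norm_num) (by linarith)] at e1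
  linarith

lemma fwdDiff (hσ : 0 ≤ σ) (h : HasOrderLE σ f) (h0 : ∀ z, meromorphicOrderAt f z ≠ ⊤) (η : ℂ) :
    HasOrderLE σ (fwdDiff η f) := by
  have hs := h.shift hσ h0 η
  have hneg : Meromorphic ((fun _ => (-1 : ℂ)) * f) := (Meromorphic.const _).mul h.1
  have heq : _root_.fwdDiff η f = (fun z => f (z + η)) + (fun _ => (-1 : ℂ)) * f := by
    ext z
    simp [_root_.fwdDiff, sub_eq_add_neg]
  rw [heq]
  refine ⟨hs.1.add hneg, ?_⟩
  refine ((hs.2.add h.2).add (OrderLE.const hσ (Real.log 2))).mono ?_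
  filter_upwards [eventually_ge_atTop 1] with r hr
  rw [abs_of_nonneg (characteristic_nonneg hr)]
  refine (characteristic_add_top_le hs.1 hneg hr).trans ?_
  have h1 := characteristic_mul_top_le hr (Meromorphic.const (-1 : ℂ))
    (fun z => by simp [meromorphicOrderAt_const]) h.1 h0
  have h2 : characteristic (fun _ : ℂ => (-1 : ℂ)) ⊤ r = 0 := by simp [characteristic]
  rw [Pi.add_apply, h2, zero_add] at h1
  linarith
end HasOrderLE
end

/-! ### Measure of the exceptional radii. -/

section
open Topology

lemma lintegral_Ioc_sub_rpow_neg {p : ℝ} (hp1 : p < 1) (x : ℝ) {B : ℝ} (hB : 0 ≤ B) :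
    ∫⁻ r in Ioc x (x + B), ENNReal.ofReal (|r - x| ^ (-p)) = ENNReal.ofReal (B ^ (1 - p) / (1 - p)) := by
  have hi : IntervalIntegrable (fun r : ℝ => |r - x| ^ (-p)) volume x (x + B) := by
    have h0 : IntervalIntegrable (fun t : ℝ => t ^ (-p)) volume 0 B :=
      intervalIntegral.intervalIntegrable_rpow' (by linarith)
    have h1 := h0.comp_sub_right x
    rw [zero_add, add_comm B] at h1
    refine h1.congr fun r hr => ?_
    rw [uIoc_of_le (by linarith)] at hr
    rw [abs_of_pos (sub_pos.2 hr.1)]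
  have hval : ∫ r in x..(x + B), |r - x| ^ (-p) = B ^ (1 - p) / (1 - p) := by
    have h1 : ∫ r in x..(x + B), |r - x| ^ (-p) = ∫ r in x..(x + B), (r - x) ^ (-p) := by
      refine intervalIntegral.integral_congr fun r hr => ?_
      rw [uIcc_of_le (by linarith)] at hr
      rw [abs_of_nonneg (sub_nonneg.2 hr.1)]
    rw [h1, intervalIntegral.integral_comp_sub_right (fun t => t ^ (-p)), sub_self,
      add_sub_cancel_left, integral_rpow (Or.inl (by linarith)), Real.zero_rpow (by linarith)]
    rw [sub_zero, neg_add_eq_sub]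
  rw [← ofReal_integral_eq_lintegral_ofReal, ← hval, intervalIntegral.integral_of_le (by linarith)]
  · exact (intervalIntegrable_iff_integrableOn_Ioc_of_le (by linarith)).1 hi
  · exact Eventually.of_forall fun r => Real.rpow_nonneg (abs_nonneg _) _

lemma lintegral_Ioc_abs_sub_rpow_neg_le {p : ℝ} (hp1 : p < 1) (x : ℝ) {B : ℝ} (hB : 0 ≤ B) :
    ∫⁻ r in Ioc (x - B) (x + B), ENNReal.ofReal (|r - x| ^ (-p))
      ≤ ENNReal.ofReal (2 * B ^ (1 - p) / (1 - p)) := by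
  have hneg : ∫⁻ r in Ioc (x - B) x, ENNReal.ofReal (|r - x| ^ (-p))
      = ENNReal.ofReal (B ^ (1 - p) / (1 - p)) := by
    rw [← lintegral_Ioc_sub_rpow_neg hp1 x hB, 
      ← Measure.restrict_congr_set (Ico_ae_eq_Ioc (μ := volume) (a := x) (b := x + B)),
      ← (Measure.measurePreserving_sub_left volume (2 * x)).setLIntegral_comp_preimage
        measurableSet_Ico (by fun_prop)]
    have hset : (fun r => 2 * x - r) ⁻¹' Ico x (x + B) = Ioc (x - B) x := by
      ext r
      simp only [mem_preimage, mem_Ico, mem_Ioc]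
      constructor <;> rintro ⟨h1, h2⟩ <;> constructor <;> linarith
    rw [hset]
    refine lintegral_congr fun r => ?_
    rw [abs_sub_comm r x]
    congr 3
    ring
  rw [← Ioc_union_Ioc_eq_Ioc (b := x) (by linarith) (by linarith)]
  refine (lintegral_union_le _ _ _).trans ?_
  rw [hneg, lintegral_Ioc_sub_rpow_neg hp1 x hB, ← ENNReal.ofReal_add]
  · exact ENNReal.ofReal_le_ofReal (by rw [mul_div_assoc, two_mul])
  all_goals exact div_nonneg (Real.rpow_nonneg hB _) (by linarith)

/-- Markov's inequality: for `p < 1` each singularity is integrable, and `[A, 2A)` lies within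
distance `B` of every `x i`. -/
lemma volume_le_sum_rpow_neg_le {p : ℝ} (hp1 : p < 1) {ι : Type*} (s : Finset ι) (d : ι → ℝ)
    (hd : ∀ i ∈ s, 0 ≤ d i) (x : ι → ℝ) {A B lam : ℝ} (hx : ∀ i ∈ s, 0 ≤ x i ∧ x i ≤ B) (hA : 0 < A)
    (hAB : 2 * A ≤ B) (hlam : 0 < lam) :
    volume {r | r ∈ Ico A (2 * A) ∧ lam ≤ ∑ i ∈ s, d i * |r - x i| ^ (-p)}
      ≤ ENNReal.ofReal ((∑ i ∈ s, d i) * (2 * B ^ (1 - p) / (1 - p)) / lam) := by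
  set K := 2 * B ^ (1 - p) / (1 - p) with hK
  have hK0 : 0 ≤ K := div_nonneg (by have := Real.rpow_nonneg (by linarith : 0 ≤ B) (1 - p); linarith)
    (by linarith)
  have hmeas : ∀ y : ℝ, Measurable fun r : ℝ => ENNReal.ofReal (|r - y| ^ (-p)) := fun y => by
    fun_prop
  have h1 : ∫⁻ r in Ico A (2 * A), ENNReal.ofReal (∑ i ∈ s, d i * |r - x i| ^ (-p))
      ≤ ENNReal.ofReal ((∑ i ∈ s, d i) * K) := by
    calc _ = ∫⁻ r in Ico A (2 * A),
          ∑ i ∈ s, ENNReal.ofReal (d i) * ENNReal.ofReal (|r - x i| ^ (-p)) := by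
          refine lintegral_congr fun r => ?_
          rw [ENNReal.ofReal_sum_of_nonneg]
          · exact Finset.sum_congr rfl fun i hi => ENNReal.ofReal_mul (hd i hi)
          · exact fun i hi => mul_nonneg (hd i hi) (Real.rpow_nonneg (abs_nonneg _) _)
      _ = ∑ i ∈ s, ENNReal.ofReal (d i) *
            ∫⁻ r in Ico A (2 * A), ENNReal.ofReal (|r - x i| ^ (-p)) := by
          rw [lintegral_finsetSum _ fun i _ => (hmeas (x i)).const_mul _]
          exact Finset.sum_congr rfl fun i _ => lintegral_const_mul _ (hmeas (x i))
      _ ≤ ∑ i ∈ s, ENNReal.ofReal (d i) * ENNReal.ofReal K := by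
          gcongr with i hi
          refine le_trans (lintegral_mono_set ?_)
            (lintegral_Ioc_abs_sub_rpow_neg_le hp1 (x i) (B := B) (by linarith))
          intro r hr
          have := hx i hi
          exact ⟨by linarith [hr.1], by linarith [hr.2]⟩
      _ = _ := by
          rw [← Finset.sum_mul, ENNReal.ofReal_mul (Finset.sum_nonneg hd),
            ENNReal.ofReal_sum_of_nonneg hd]
  have h2 : Measurable fun r : ℝ => ENNReal.ofReal (∑ i ∈ s, d i * |r - x i| ^ (-p)) := by
    fun_prop
  calc _ ≤ volume.restrict (Ico A (2 * A)) {r | ENNReal.ofReal lam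
          ≤ ENNReal.ofReal (∑ i ∈ s, d i * |r - x i| ^ (-p))} := by
        rw [Measure.restrict_apply (measurableSet_le measurable_const h2)]
        exact measure_mono fun r hr => ⟨ENNReal.ofReal_le_ofReal hr.2, hr.1⟩
    _ ≤ (∫⁻ r in Ico A (2 * A), ENNReal.ofReal (∑ i ∈ s, d i * |r - x i| ^ (-p)))
          / ENNReal.ofReal lam :=
        meas_ge_le_lintegral_div h2.aemeasurable (by simpa using hlam) ENNReal.ofReal_ne_top
    _ ≤ _ := by
        rw [ENNReal.ofReal_div_of_pos hlam]
        gcongr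

/-- On `E k` the density `1 / r` is at most `2 ^ (-k)`, so the logarithmic measures are dominated by
a geometric series of ratio `2 ^ (-δ)`. -/
lemma logMeasure_iUnion_lt_top {E : ℕ → Set ℝ} {C δ : ℝ} (hδ : 0 < δ)
    (hE : ∀ k, E k ⊆ Ici (2 ^ k)) (hmE : ∀ k, MeasurableSet (E k))
    (hv : ∀ k, volume (E k) ≤ ENNReal.ofReal (C * (2 ^ k) ^ (1 - δ))) :
    logMeasure (⋃ k, E k) < ⊤ := by
  have hone : ∀ k, ∫⁻ r in E k, ENNReal.ofReal (1 / r) ≤ ENNReal.ofReal (C * (2 ^ (-δ)) ^ k) := by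
    intro k
    have hpos : (0 : ℝ) < 2 ^ k := by positivity
    calc ∫⁻ r in E k, ENNReal.ofReal (1 / r) ≤ ∫⁻ r in E k, ENNReal.ofReal (1 / 2 ^ k) := by
          refine setLIntegral_mono' (hmE k) fun r hr => ?_
          exact ENNReal.ofReal_le_ofReal (one_div_le_one_div_of_le hpos (hE k hr))
      _ = ENNReal.ofReal (1 / 2 ^ k) * volume (E k) := by simp
      _ ≤ ENNReal.ofReal (1 / 2 ^ k) * ENNReal.ofReal (C * (2 ^ k) ^ (1 - δ)) := by
          gcongr; exact hv k
      _ = _ := by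
          rw [← ENNReal.ofReal_mul (by positivity)]
          congr 1
          rw [Real.rpow_sub hpos, Real.rpow_one, ← Real.rpow_natCast_mul (by norm_num),
            ← Real.rpow_natCast, ← Real.rpow_natCast, ← Real.rpow_mul (by norm_num),
            mul_comm (k : ℝ) δ, neg_mul, Real.rpow_neg (by norm_num)]
          field_simp
  have hsum : Summable fun k : ℕ => C * ((2 : ℝ) ^ (-δ)) ^ k :=
    (summable_geometric_of_lt_one (by positivity)
      (Real.rpow_lt_one_of_one_lt_of_neg (by norm_num) (by linarith))).mul_left C
  calc logMeasure (⋃ k, E k) ≤ ∫⁻ r in ⋃ k, E k, ENNReal.ofReal (1 / r) :=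
        lintegral_mono_set inter_subset_left
    _ ≤ ∑' k, ∫⁻ r in E k, ENNReal.ofReal (1 / r) := lintegral_iUnion_le _ _
    _ ≤ ∑' k, ENNReal.ofReal (C * (2 ^ (-δ)) ^ k) := ENNReal.tsum_le_tsum hone
    _ < ⊤ := hsum.tsum_ofReal_lt_top
end

/-! ### Pointwise form of the shift, and properties holding off small sets of radii. -/

section
open Metric Topology Asymptotics

lemma exists_shift_eq_mul_exp_of_meromorphic {f : ℂ → ℂ} (hf : Meromorphic f)
    (h0 : ∀ z, meromorphicOrderAt f z ≠ ⊤) {R : ℝ} (hR : 1 ≤ R) {z η : ℂ}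
    (hz : ‖z‖ ≤ R / 4) (hη : ‖η‖ ≤ R / 8) (hgz : AnalyticAt ℂ f z ∧ f z ≠ 0)
    (hgη : AnalyticAt ℂ f (z + η) ∧ f (z + η) ≠ 0)
    (hsmall : ∀ a ∈ zerosPoles f R, ‖η‖ * ‖z - a‖⁻¹ ≤ 1 / 2) :
    ∃ W : ℂ, f (z + η) = f z * Complex.exp W ∧
      ‖W‖ ≤ 3 / 2 * ‖η‖ * ∑ a ∈ zerosPoles f R, |(ord f a : ℝ)| * ‖z - a‖⁻¹
        + 96 * (zeroFreeBound f R + 1) * ‖η‖ / R := by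
  obtain ⟨g, hg, hg0, he⟩ := exists_factorization hf h0 R
  have hM := circleAverage_abs_log_norm_le_zeroFreeBound hf hR hg0 he
  obtain ⟨w, hw, hwb⟩ := exists_shift_eq_mul_exp (by linarith) hg hg0
    (hM.trans (by linarith : _ ≤ zeroFreeBound f R + 1))
    (by linarith [zeroFreeBound_nonneg f hR]) hz hη
  have hz1 := eq_factorization hf hg he (by linarith) hgz.1 hgz.2
  have hz2 := eq_factorization hf hg he (by linarith [norm_add_le z η]) hgη.1 hgη.2
  have hx : ∀ a ∈ zerosPoles f R, ‖η / (z - a)‖ ≤ 1 / 2 := fun a ha => by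
    rw [norm_div, div_eq_mul_inv]; exact hsmall a ha
  refine ⟨∑ a ∈ zerosPoles f R, (ord f a : ℂ) * Complex.log (1 + η / (z - a)) + w, ?_, ?_⟩
  · rw [Complex.exp_add, Complex.exp_sum, hz2, hw]
    have hprod : ∏ a ∈ zerosPoles f R, (z + η - a) ^ ord f a
        = (∏ a ∈ zerosPoles f R, (z - a) ^ ord f a) *
          ∏ a ∈ zerosPoles f R, Complex.exp ((ord f a : ℂ) * Complex.log (1 + η / (z - a))) := by
      rw [← Finset.prod_mul_distrib]
      refine Finset.prod_congr rfl fun a ha => ?_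
      have hza : z - a ≠ 0 := fun h => by
        rw [sub_eq_zero] at h
        exact ((mem_zerosPoles hf).1 ha).2 (h ▸ ord_eq_zero hgz.1 hgz.2)
      have hne : 1 + η / (z - a) ≠ 0 := fun h => by
        have h1 : η / (z - a) = -1 := by linear_combination h
        have := hx a ha
        rw [h1] at this
        norm_num at this
      rw [Complex.exp_int_mul, Complex.exp_log hne, ← mul_zpow]
      congr 1
      field_simp
      ring
    rw [hprod, hz1]
    ring
  · refine (norm_add_le _ _).trans (add_le_add ?_ hwb)
    rw [Finset.mul_sum]
    refine (norm_sum_le _ _).trans (Finset.sum_le_sum fun a ha => ?_)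
    rw [norm_mul, Complex.norm_intCast]
    calc |(ord f a : ℝ)| * ‖Complex.log (1 + η / (z - a))‖
        ≤ |(ord f a : ℝ)| * (3 / 2 * ‖η / (z - a)‖) := by
          gcongr; exact Complex.norm_log_one_add_half_le_self (hx a ha)
      _ = _ := by rw [norm_div]; ring

/-- As the weights are at least `1`, every single `y i ^ (-p)` is at most `lam`; so `(y i)⁻¹`, which
is `y i ^ (-p)` to the power `1 + (1 / p - 1)`, loses only `lam ^ (1 / p - 1)`. -/
lemma sum_inv_le_rpow {p lam : ℝ} (hp0 : 0 < p) (hp1 : p < 1) {ι : Type*} (s : Finset ι)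
    (d y : ι → ℝ) (hd : ∀ i ∈ s, 1 ≤ d i) (hy : ∀ i ∈ s, 0 < y i)
    (h : ∑ i ∈ s, d i * y i ^ (-p) ≤ lam) :
    ∑ i ∈ s, d i * (y i)⁻¹ ≤ lam ^ (1 / p) := by
  have hterm : ∀ i ∈ s, 0 ≤ d i * y i ^ (-p) := fun i hi =>
    mul_nonneg (by linarith [hd i hi]) (Real.rpow_nonneg (hy i hi).le _)
  have hlam : 0 ≤ lam := (Finset.sum_nonneg hterm).trans h
  have hle : ∀ i ∈ s, y i ^ (-p) ≤ lam := fun i hi =>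
    ((le_mul_of_one_le_left (Real.rpow_nonneg (hy i hi).le _) (hd i hi)).trans
      (Finset.single_le_sum hterm hi)).trans h
  have hp' : 0 < 1 / p - 1 := by rw [sub_pos, one_lt_div hp0]; exact hp1
  calc ∑ i ∈ s, d i * (y i)⁻¹ ≤ ∑ i ∈ s, d i * y i ^ (-p) * lam ^ (1 / p - 1) := by
        refine Finset.sum_le_sum fun i hi => ?_
        have hyi := hy i hi
        rw [mul_assoc]
        refine mul_le_mul_of_nonneg_left ?_ (by linarith [hd i hi])
        have : (y i)⁻¹ = y i ^ (-p) * (y i ^ (-p)) ^ (1 / p - 1) := by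
          rw [← Real.rpow_mul hyi.le, ← Real.rpow_add hyi, ← Real.rpow_neg_one]
          congr 1
          field_simp
          ring
        rw [this]
        gcongr
        exact hle i hi
    _ = (∑ i ∈ s, d i * y i ^ (-p)) * lam ^ (1 / p - 1) := by rw [Finset.sum_mul]
    _ ≤ lam * lam ^ (1 / p - 1) := by gcongr
    _ = lam ^ (1 / p) := by
        rcases eq_or_lt_of_le hlam with h0 | h0
        · rw [← h0, zero_mul, Real.zero_rpow (by positivity)]
        · nth_rewrite 1 [← Real.rpow_one lam]
          rw [← Real.rpow_add h0]
          congr 1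
          ring

/-- `P` holds at all points outside the closed unit disc whose modulus does not belong to a certain
set of finite logarithmic measure. -/
def OffSmall (P : ℂ → Prop) : Prop :=
  ∃ E : Set ℝ, MeasurableSet E ∧ logMeasure E < ⊤ ∧ ∀ z : ℂ, 1 < ‖z‖ → ‖z‖ ∉ E → P z

lemma logMeasure_union_le (E F : Set ℝ) : logMeasure (E ∪ F) ≤ logMeasure E + logMeasure F := by
  rw [logMeasure, union_inter_distrib_right]
  exact lintegral_union_le _ _ _

namespace OffSmall
variable {P Q : ℂ → Prop}

lemma mono (h : OffSmall P) (hPQ : ∀ z, 1 < ‖z‖ → P z → Q z) : OffSmall Q := by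
  obtain ⟨E, h1, h2, h3⟩ := h
  exact ⟨E, h1, h2, fun z hz hzE => hPQ z hz (h3 z hz hzE)⟩

lemma and (hP : OffSmall P) (hQ : OffSmall Q) : OffSmall (fun z => P z ∧ Q z) := by
  obtain ⟨E, h1, h2, h3⟩ := hP
  obtain ⟨F, h4, h5, h6⟩ := hQ
  refine ⟨E ∪ F, h1.union h4, (logMeasure_union_le E F).trans_lt (ENNReal.add_lt_top.2 ⟨h2, h5⟩),
    fun z hz hzE => ?_⟩
  rw [mem_union, not_or] at hzE
  exact ⟨h3 z hz hzE.1, h6 z hz hzE.2⟩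

lemma of_countable {B : Set ℂ} (hB : B.Countable) :
    OffSmall (fun z => ∀ a, ‖a‖ = ‖z‖ → a ∉ B) := by
  have hc := hB.image (fun z => ‖z‖)
  refine ⟨_, hc.measurableSet, ?_, fun z _ hz a ha haB => hz ⟨a, haB, ha⟩⟩
  rw [logMeasure, Measure.restrict_eq_zero.2 ((hc.mono inter_subset_left).measure_zero volume)]
  simp

lemma of_le_norm (M : ℝ) : OffSmall (fun z => M < ‖z‖) := by
  refine ⟨Iic M, measurableSet_Iic, ?_, fun z _ hz => by simpa using hz⟩
  calc logMeasure (Iic M) ≤ ∫⁻ _ in Iic M ∩ Ioi 1, 1 := by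
        refine setLIntegral_mono' (measurableSet_Iic.inter measurableSet_Ioi) fun r hr => ?_
        rw [ENNReal.ofReal_le_one, one_div]
        exact inv_le_one_of_one_le₀ (le_of_lt hr.2)
    _ = volume (Ioc 1 M) := by rw [setLIntegral_one, inter_comm, Ioi_inter_Iic]
    _ < ⊤ := by simp

end OffSmall

lemma countable_not_analyticAt_ne_zero {f : ℂ → ℂ} (hf : Meromorphic f)
    (h0 : ∀ z, meromorphicOrderAt f z ≠ ⊤) : {z | AnalyticAt ℂ f z ∧ f z ≠ 0}ᶜ.Countable := by
  refine (HereditarilyLindelofSpace.isLindelof _).countable_of_isDiscrete ?_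
  exact (mem_codiscrete'.1 (eventually_analyticAt_ne_zero hf h0)).2

/-- The whole circle through `z` must avoid zeros and poles, not only `z`, because later sums
involve the distances `|‖z‖ - ‖a‖|`. -/
lemma offSmall_good {f : ℂ → ℂ} (hf : Meromorphic f) (h0 : ∀ z, meromorphicOrderAt f z ≠ ⊤)
    (η : ℂ) : OffSmall (fun z => (∀ a, ‖a‖ = ‖z‖ → AnalyticAt ℂ f a ∧ f a ≠ 0) ∧
      AnalyticAt ℂ f (z + η) ∧ f (z + η) ≠ 0) := by
  have hB := countable_not_analyticAt_ne_zero hf h0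
  refine ((OffSmall.of_countable hB).and (OffSmall.of_countable
    (hB.preimage (add_left_injective η)))).mono fun z _ hz => ⟨fun a ha => ?_, ?_⟩
  · simpa using hz.1 a ha
  · by_contra h
    exact hz.2 z rfl h
end

/-! ### The first difference quotient and iteration. -/

section
open Metric Topology Asymptotics

lemma OrderLE.exists_bound {σ τ : ℝ} {u : ℝ → ℝ} (hu : OrderLE σ u) (h : σ < τ) :
    ∃ C > 0, ∀ᶠ r in atTop, u r ≤ C * r ^ τ := by
  obtain ⟨C, hC, hb⟩ := (hu τ h).exists_pos
  refine ⟨C, hC, ?_⟩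
  filter_upwards [hb.bound, eventually_gt_atTop 0] with r hr hr0
  rw [Real.norm_of_nonneg (Real.rpow_nonneg hr0.le _)] at hr
  exact (le_abs_self _).trans hr

/-- The set of `r ∈ [A, 2 A)` at which a weighted sum over the zeros and poles of `f` is large. -/
def badRadii (f : ℂ → ℂ) (p s A : ℝ) : Set ℝ :=
  {r | r ∈ Ico A (2 * A) ∧
    A ^ s ≤ ∑ a ∈ zerosPoles f (8 * A), |(ord f a : ℝ)| * |r - ‖a‖| ^ (-p)}

lemma measurableSet_badRadii (f : ℂ → ℂ) (p s A : ℝ) : MeasurableSet (badRadii f p s A) := by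
  have h2 : Measurable fun r : ℝ =>
      ∑ a ∈ zerosPoles f (8 * A), |(ord f a : ℝ)| * |r - ‖a‖| ^ (-p) := by
    fun_prop
  exact measurableSet_Ico.inter (measurableSet_le measurable_const h2)

lemma volume_badRadii_le {f : ℂ → ℂ} (hf : Meromorphic f) {p s A C τ : ℝ} (hp1 : p < 1) (hA : 0 < A)
    (hC : zpCount f (8 * A) ≤ C * A ^ τ) :
    volume (badRadii f p s A)
      ≤ ENNReal.ofReal (C * (2 * 8 ^ (1 - p) / (1 - p)) * A ^ (τ + (1 - p) - s)) := by
  refine (volume_le_sum_rpow_neg_le hp1 (zerosPoles f (8 * A)) (fun a => |(ord f a : ℝ)|)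
    (fun _ _ => abs_nonneg _) (fun a => ‖a‖) (B := 8 * A)
    (fun a ha => ⟨norm_nonneg _, ((mem_zerosPoles hf).1 ha).1⟩) hA (by linarith)
    (Real.rpow_pos_of_pos hA s)).trans (ENNReal.ofReal_le_ofReal ?_)
  have h1p : 0 < 1 - p := by linarith
  calc _ ≤ C * A ^ τ * (2 * (8 * A) ^ (1 - p) / (1 - p)) / A ^ s := by
        gcongr; exact hC
    _ = _ := by
        rw [Real.mul_rpow (by norm_num) hA.le, Real.rpow_sub hA (τ + (1 - p)), Real.rpow_add hA]
        ring

/-- Distances between moduli bound distances between points from below. The hypothesis `hgood`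
excludes `‖z‖ = ‖a‖`, where `0 ^ (-p)` takes the value `0` and `badRadii` would not notice the
singularity. -/
lemma sum_inv_dist_le {f : ℂ → ℂ} (hf : Meromorphic f) {p s A : ℝ} (hp0 : 0 < p) (hp1 : p < 1)
    (hA : 0 < A) {z : ℂ} (hz : ‖z‖ ∈ Ico A (2 * A)) (hbad : ‖z‖ ∉ badRadii f p s A)
    (hgood : ∀ a, ‖a‖ = ‖z‖ → ord f a = 0) :
    ∑ a ∈ zerosPoles f (8 * A), |(ord f a : ℝ)| * ‖z - a‖⁻¹ ≤ A ^ (s / p) := by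
  have hpos : ∀ a ∈ zerosPoles f (8 * A), 0 < |‖z‖ - ‖a‖| := fun a ha => by
    rw [abs_pos, sub_ne_zero]
    intro h
    exact ((mem_zerosPoles hf).1 ha).2 (hgood a h.symm)
  have h1 : ∑ a ∈ zerosPoles f (8 * A), |(ord f a : ℝ)| * |‖z‖ - ‖a‖| ^ (-p) ≤ A ^ s := by
    by_contra h
    exact hbad ⟨hz, (not_le.1 h).le⟩
  have h2 := sum_inv_le_rpow hp0 hp1 _ _ _ (fun a ha => by
    have := Int.one_le_abs ((mem_zerosPoles hf).1 ha).2
    exact_mod_cast this) hpos h1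
  rw [← Real.rpow_mul hA.le, mul_one_div] at h2
  refine le_trans (Finset.sum_le_sum fun a ha => ?_) h2
  refine mul_le_mul_of_nonneg_left ?_ (abs_nonneg _)
  exact inv_anti₀ (hpos a ha) (abs_norm_sub_norm_le z a)

lemma offSmall_norm_fwdDiff_div_le_of_lt_one {f : ℂ → ℂ} {σ ε : ℝ} (hσ : 0 ≤ σ)
    (hf : HasOrderLE σ f) (h0 : ∀ z, meromorphicOrderAt f z ≠ ⊤) (η : ℂ) (hε : 0 < ε)
    (hσε : σ + ε < 1) :
    OffSmall (fun z => AnalyticAt ℂ f z ∧ f z ≠ 0 ∧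
      ‖fwdDiff η f z / f z‖ ≤ ‖z‖ ^ (σ - 1 + ε)) := by
  -- The count of zeros and poles gets exponent `σ + ε / 4`. With `s + p = σ + ε / 2` the bad radii
  -- in `[A, 2A)` have measure `O(A ^ (1 - ε / 4))`; the choice of `p` makes the sum of inverse
  -- distances at most `A ^ (s / p) = A ^ (θ - 1)`. The remaining `ε / 4` absorbs constants.
  set θ := σ + 3 * ε / 4 with hθ
  set p := (σ + ε / 2) / θ with hp
  set s := σ + ε / 2 - p with hs
  have hθ0 : 0 < θ := by positivity
  have hp0 : 0 < p := by positivity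
  have hp1 : p < 1 := by rw [hp, div_lt_one hθ0]; linarith
  have hsp : s / p = θ - 1 := by
    rw [hs, sub_div, div_self hp0.ne', hp]
    field_simp
  obtain ⟨C₁, hC₁, hn⟩ := ((hf.zpCount hσ).comp_mul (c := 8) (by norm_num)).exists_bound
    (τ := σ + ε / 4) (by linarith)
  obtain ⟨C₂, hC₂, hb⟩ := (((hf.zeroFreeBound hσ).comp_mul (c := 8) (by norm_num)).add
    (OrderLE.const hσ 1)).exists_bound (τ := θ) (by linarith)
  set K := 3 / 2 * ‖η‖ + 12 * C₂ * ‖η‖ with hK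
  have hK0 : 0 ≤ K := by positivity
  have hlim : ∀ c e : ℝ, 0 < e → Tendsto (fun A : ℝ => c * A ^ (-e)) atTop (𝓝 0) := fun c e he => by
    simpa using (tendsto_rpow_neg_atTop he).const_mul c
  have hev : ∀ᶠ A : ℝ in atTop, zpCount f (8 * A) ≤ C₁ * A ^ (σ + ε / 4) ∧
      zeroFreeBound f (8 * A) + 1 ≤ C₂ * A ^ θ ∧ ‖η‖ ≤ A ∧ 1 ≤ A ∧
      ‖η‖ * A ^ (θ - 1) ≤ 1 / 2 ∧ K * A ^ (θ - 1) ≤ 1 ∧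
      2 * K * A ^ (θ - 1) ≤ (2 * A) ^ (σ - 1 + ε) := by
    filter_upwards [hn, hb, eventually_ge_atTop ‖η‖, eventually_ge_atTop 1,
      (hlim ‖η‖ (1 - θ) (by linarith)).eventually_le_const (by norm_num : (0 : ℝ) < 1 / 2),
      (hlim K (1 - θ) (by linarith)).eventually_le_const one_pos,
      (hlim (2 * K) (ε / 4) (by linarith)).eventually_le_const
        (by positivity : (0 : ℝ) < 2 ^ (σ - 1 + ε))] with A a1 a2 a3 a4 a5 a6 a7
    rw [neg_sub] at a5 a6
    refine ⟨a1, a2, a3, a4, a5, a6, ?_⟩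
    have hA : 0 < A := by linarith
    have : θ - 1 = -(ε / 4) + (σ - 1 + ε) := by rw [hθ]; ring
    rw [this, Real.rpow_add hA, Real.mul_rpow (by norm_num) hA.le, ← mul_assoc]
    gcongr
  obtain ⟨A₀, hA₀⟩ := eventually_atTop.1 hev
  obtain ⟨k₀, hk₀⟩ := pow_unbounded_of_one_lt A₀ (by norm_num : (1 : ℝ) < 2)
  have hkA : ∀ k, k₀ ≤ k → A₀ ≤ 2 ^ k := fun k hk =>
    hk₀.le.trans (pow_le_pow_right₀ (by norm_num) hk)
  have hbad : OffSmall (fun z => ∀ k, k₀ ≤ k → ‖z‖ ∉ badRadii f p s (2 ^ k)) := by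
    -- The growth bounds hold only from `k₀` on; the smaller moduli are discarded separately by
    -- `OffSmall.of_le_norm`.
    refine ⟨⋃ k, {r | k₀ ≤ k ∧ r ∈ badRadii f p s (2 ^ k)}, ?_, ?_, ?_⟩
    · exact MeasurableSet.iUnion fun k =>
        (MeasurableSet.const _).inter (measurableSet_badRadii f p s _)
    · refine logMeasure_iUnion_lt_top (C := C₁ * (2 * 8 ^ (1 - p) / (1 - p))) (δ := ε / 4)
        (by linarith) (fun k r hr => hr.2.1.1) (fun k => (MeasurableSet.const _).inter
          (measurableSet_badRadii f p s _)) fun k => ?_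
      by_cases hk : k₀ ≤ k
      · refine (measure_mono fun r hr => hr.2).trans
          ((volume_badRadii_le hf.1 hp1 (by positivity) (hA₀ _ (hkA k hk)).1).trans (le_of_eq ?_))
        congr 3
        rw [hs]; ring
      · simp [hk]
    · intro z _ hz k hk hzk
      exact hz (mem_iUnion.2 ⟨k, hk, hzk⟩)
  refine ((offSmall_good hf.1 h0 η).and (hbad.and (OffSmall.of_le_norm (2 ^ k₀)))).mono ?_
  rintro z hz1 ⟨⟨hgz, hgη⟩, hzbad, hzk⟩
  have hgz' := hgz z rfl
  refine ⟨hgz'.1, hgz'.2, ?_⟩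
  obtain ⟨k, hk1, hk2⟩ := exists_nat_pow_near hz1.le (by norm_num : (1 : ℝ) < 2)
  have hk : k₀ ≤ k := by
    have := (pow_lt_pow_iff_right₀ (by norm_num : (1 : ℝ) < 2)).1 (hzk.trans hk2)
    omega
  have hzb := hzbad k hk
  obtain ⟨a1, a2, a3, a4, a5, a6, a7⟩ := hA₀ _ (hkA k hk)
  rw [pow_succ, mul_comm] at hk2
  set A : ℝ := 2 ^ k with hAdef
  have hA : 0 < A := by linarith
  have hord : ∀ a, ‖a‖ = ‖z‖ → ord f a = 0 := fun a ha => ord_eq_zero (hgz a ha).1 (hgz a ha).2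
  have hsum := sum_inv_dist_le hf.1 hp0 hp1 hA ⟨hk1, hk2⟩ hzb hord
  rw [hsp] at hsum
  obtain ⟨W, hW, hWb⟩ := exists_shift_eq_mul_exp_of_meromorphic hf.1 h0 (R := 8 * A) (by linarith)
    (by linarith) (by linarith) hgz' hgη fun a ha => by
      refine le_trans (mul_le_mul_of_nonneg_left ?_ (norm_nonneg _)) a5
      refine le_trans ?_ hsum
      refine le_trans ?_ (Finset.single_le_sum (fun a _ => by positivity) ha)
      refine le_mul_of_one_le_left (by positivity) ?_
      exact_mod_cast Int.one_le_abs ((mem_zerosPoles hf.1).1 ha).2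
  have hWK : ‖W‖ ≤ K * A ^ (θ - 1) := by
    refine hWb.trans ?_
    rw [hK, add_mul]
    refine add_le_add (by gcongr) ?_
    rw [Real.rpow_sub_one hA.ne', div_le_iff₀ (by positivity)]
    calc 96 * (zeroFreeBound f (8 * A) + 1) * ‖η‖ ≤ 96 * (C₂ * A ^ θ) * ‖η‖ := by gcongr
      _ = _ := by field_simp; ring
  have hdiv : fwdDiff η f z / f z = Complex.exp W - 1 := by
    rw [fwdDiff, hW]
    field_simp [hgz'.2]
  rw [hdiv]
  calc ‖Complex.exp W - 1‖ ≤ 2 * ‖W‖ := Complex.norm_exp_sub_one_le (hWK.trans a6)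
    _ ≤ 2 * K * A ^ (θ - 1) := by linarith
    _ ≤ (2 * A) ^ (σ - 1 + ε) := a7
    -- The exponent is negative by `hσε`, so the upper bound `‖z‖ < 2 * A` is the one that matters.
    _ ≤ ‖z‖ ^ (σ - 1 + ε) :=
        Real.rpow_le_rpow_of_nonpos (by linarith) hk2.le (by linarith)

lemma offSmall_norm_fwdDiff_div_le {f : ℂ → ℂ} {σ ε : ℝ} (hσ : 0 ≤ σ) (hσ1 : σ < 1)
    (hf : HasOrderLE σ f) (h0 : ∀ z, meromorphicOrderAt f z ≠ ⊤) (η : ℂ) (hε : 0 < ε) :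
    OffSmall (fun z => AnalyticAt ℂ f z ∧ f z ≠ 0 ∧
      ‖fwdDiff η f z / f z‖ ≤ ‖z‖ ^ (σ - 1 + ε)) := by
  refine (offSmall_norm_fwdDiff_div_le_of_lt_one (ε := min ε ((1 - σ) / 2)) hσ hf h0 η
    (lt_min hε (by linarith)) (by linarith [min_le_right ε ((1 - σ) / 2)])).mono ?_
  rintro z hz ⟨h1, h2, h3⟩
  exact ⟨h1, h2, h3.trans (Real.rpow_le_rpow_of_exponent_le hz.le
    (by linarith [min_le_left ε ((1 - σ) / 2)]))⟩

lemma meromorphic_fwdDiff_iterate {f : ℂ → ℂ} (hf : Meromorphic f) (η : ℂ) (n : ℕ) :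
    Meromorphic ((fwdDiff η)^[n] f) := by
  induction n generalizing f with
  | zero => exact hf
  | succ n ih => exact ih ((meromorphic_shift hf η).sub hf)

lemma meromorphicOrderAt_fwdDiff_eq_top {f : ℂ → ℂ} (h : ∀ z, meromorphicOrderAt f z = ⊤) (η z : ℂ) :
    meromorphicOrderAt (fwdDiff η f) z = ⊤ := by
  have h1 := h (z + η)
  rw [← meromorphicOrderAt_comp_add_const_eq_meromorphicOrderAt, meromorphicOrderAt_eq_top_iff] at h1
  rw [meromorphicOrderAt_eq_top_iff]
  filter_upwards [h1, meromorphicOrderAt_eq_top_iff.1 (h z)] with w hw1 hw2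
  simp only [Function.comp_apply] at hw1
  rw [fwdDiff, hw1, hw2, sub_zero]

lemma meromorphicOrderAt_fwdDiff_iterate_eq_top {f : ℂ → ℂ} (h : ∀ z, meromorphicOrderAt f z = ⊤)
    (η : ℂ) (n : ℕ) (z : ℂ) : meromorphicOrderAt ((fwdDiff η)^[n] f) z = ⊤ := by
  induction n generalizing f with
  | zero => exact h z
  | succ n ih => exact ih (meromorphicOrderAt_fwdDiff_eq_top h η)

lemma meromorphicOrderAt_eq_top_or_ne_top {f : ℂ → ℂ} (hf : Meromorphic f) :
    (∀ z, meromorphicOrderAt f z = ⊤) ∨ ∀ z, meromorphicOrderAt f z ≠ ⊤ := by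
  rw [← hf.exists_meromorphicOrderAt_ne_top_iff_forall, or_iff_not_imp_left]
  intro h
  push Not at h
  exact h

/-- If the last difference is not identically zero then no earlier one is, so the bound for one
difference applies at each stage. -/
lemma HasOrderLE.fwdDiff_iterate {f : ℂ → ℂ} {σ : ℝ} (hσ : 0 ≤ σ) (hf : HasOrderLE σ f) (η : ℂ)
    (n : ℕ) (h : ∀ z, meromorphicOrderAt ((_root_.fwdDiff η)^[n] f) z ≠ ⊤) :
    HasOrderLE σ ((_root_.fwdDiff η)^[n] f) := by
  induction n with
  | zero => exact hf
  | succ n ih =>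
    rw [Function.iterate_succ_apply'] at h ⊢
    rcases meromorphicOrderAt_eq_top_or_ne_top
      (meromorphic_fwdDiff_iterate hf.1 η n) with h1 | h1
    · exact absurd (meromorphicOrderAt_fwdDiff_eq_top h1 η 0) (h 0)
    · exact (ih h1).fwdDiff hσ h1 η

lemma offSmall_norm_fwdDiff_iterate_div_le {f : ℂ → ℂ} {σ : ℝ} (hσ : 0 ≤ σ) (hσ1 : σ < 1)
    (hf : HasOrderLE σ f) (h0 : ∀ z, meromorphicOrderAt f z ≠ ⊤) (η : ℂ) (n : ℕ) {ε : ℝ}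
    (hε : 0 < ε) :
    OffSmall (fun z => AnalyticAt ℂ f z ∧ AnalyticAt ℂ ((fwdDiff η)^[n] f) z ∧ f z ≠ 0 ∧
      ‖(fwdDiff η)^[n] f z / f z‖ ≤ ‖z‖ ^ (n * (σ - 1) + ε)) := by
  induction n generalizing f ε with
  | zero =>
    refine (offSmall_good hf.1 h0 η).mono fun z hz h => ?_
    have := h.1 z rfl
    refine ⟨this.1, this.1, this.2, ?_⟩
    simp only [Function.iterate_zero, id, div_self this.2, norm_one]
    exact Real.one_le_rpow hz.le (by simpa using hε.le)
  | succ n ih =>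
    rw [Function.iterate_succ_apply]
    have hm : Meromorphic (fwdDiff η f) := (meromorphic_shift hf.1 η).sub hf.1
    rcases meromorphicOrderAt_eq_top_or_ne_top hm with h1 | h1
    -- If `Δf` vanishes identically off a discrete set, the iterate is zero wherever it is analytic,
    -- and the estimate is trivial.
    · have hc := (meromorphic_fwdDiff_iterate hm η n).countable_compl_analyticAt
      refine ((offSmall_good hf.1 h0 η).and (OffSmall.of_countable hc)).mono
        fun z hz h => ?_
      have hg := h.1.1 z rfl
      have han : AnalyticAt ℂ ((fwdDiff η)^[n] (fwdDiff η f)) z := by simpa using h.2 z rfl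
      have htop := meromorphicOrderAt_eq_top_iff.1
        (meromorphicOrderAt_fwdDiff_iterate_eq_top h1 η n z)
      have hzero : (fwdDiff η)^[n] (fwdDiff η f) z = 0 :=
        tendsto_nhds_unique (han.continuousAt.tendsto.mono_left nhdsWithin_le_nhds)
          (tendsto_const_nhds.congr' (htop.mono fun _ hw => hw.symm))
      refine ⟨hg.1, han, hg.2, ?_⟩
      rw [hzero, zero_div, norm_zero]
      positivity
    · have h2 := ih (hf.fwdDiff hσ h0 η) h1 (half_pos hε)
      have h3 := offSmall_norm_fwdDiff_div_le hσ hσ1 hf h0 η (half_pos hε)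
      refine (h2.and h3).mono ?_
      rintro z hz ⟨⟨_, h5, h6, h7⟩, h8, h9, h10⟩
      refine ⟨h8, h5, h9, ?_⟩
      -- Telescoping through `Δf`; each of the two factors spends `ε / 2`.
      rw [← div_mul_div_cancel₀ h6, norm_mul]
      refine (mul_le_mul h7 h10 (norm_nonneg _) (by positivity)).trans (le_of_eq ?_)
      rw [← Real.rpow_add (by linarith)]
      congr 1
      push_cast
      ring
end

theorem theorem5p1 (f : ℂ → ℂ) (hf : Meromorphic f)
    (σ : ℝ) (hσ : nevanlinnaOrder f = (σ : EReal)) (hσ1 : σ < 1)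
    (η : ℂ) (hη : η ≠ 0) (ε : ℝ) (hε : 0 < ε) (j k : ℕ) (hjk : j < k)
    -- the meromorphic function in the denominator is not identically zero
    (hj : ¬ ((fwdDiff η)^[j] f =ᶠ[codiscrete ℂ] 0)) :
    ∃ E : Set ℝ, E ⊆ Set.Ioi 1 ∧ MeasurableSet E ∧ logMeasure E < ⊤ ∧
      ∀ z : ℂ, ‖z‖ ∉ E ∪ Set.Icc 0 1 →
        -- the quotient is well defined at `z`: no poles, and no zero of the denominator
        AnalyticAt ℂ ((fwdDiff η)^[j] f) z ∧ AnalyticAt ℂ ((fwdDiff η)^[k] f) z ∧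
        (fwdDiff η)^[j] f z ≠ 0 ∧
        ‖(fwdDiff η)^[k] f z / (fwdDiff η)^[j] f z‖ ≤ ‖z‖ ^ (((k : ℝ) - j) * (σ - 1) + ε) := by
  obtain ⟨hσ0, hord⟩ := orderLE_of_nevanlinnaOrder hσ
  have hne : ∀ z, meromorphicOrderAt ((fwdDiff η)^[j] f) z ≠ ⊤ := by
    refine (meromorphicOrderAt_eq_top_or_ne_top
      (meromorphic_fwdDiff_iterate hf η j)).resolve_left fun h => hj ?_
    rw [Filter.EventuallyEq, Filter.Eventually, codiscrete,
      mem_codiscreteWithin_iff_forall_mem_nhdsNE]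
    intro x _
    rw [compl_univ, union_empty]
    exact meromorphicOrderAt_eq_top_iff.1 (h x)
  -- The case of a general denominator is the case `j = 0` for the function `Δ^j f`, with `k - j`
  -- differences.
  obtain ⟨E, hE, hlog, hz⟩ := offSmall_norm_fwdDiff_iterate_div_le hσ0 hσ1
    (HasOrderLE.fwdDiff_iterate hσ0 ⟨hf, hord⟩ η j hne) hne η (k - j) hε
  refine ⟨E ∩ Ioi 1, inter_subset_right, hE.inter measurableSet_Ioi, ?_, fun z hzE => ?_⟩
  · rwa [logMeasure, inter_assoc, inter_self]
  · rw [mem_union, not_or] at hzE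
    have hz1 : 1 < ‖z‖ := by
      by_contra h
      exact hzE.2 ⟨norm_nonneg z, not_lt.1 h⟩
    have := hz z hz1 fun h => hzE.1 ⟨h, hz1⟩
    rwa [← Function.iterate_add_apply, Nat.sub_add_cancel hjk.le, Nat.cast_sub hjk.le] at this
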